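/- Consider an instance of the Quickest Transshipment Problem: a finite directed graph with node set $V$ and arc set $A$, $m:=|A|$, capacities $u\in\mathbb{R}^A_{\ge 0}$, transit times $\tau\in\mathbb{R}^A_{\ge 0}$, disjoint sets $S^+,S^-\subseteq V$ of sources and sinks, $k:=|S^+\cup S^-|$, and supplies/demands $b$ with $b\ge 0$ on $S^+$, $b\le 0$ on $S^-$ and $\sum_{v\in S^+\cup S^-}b(v)=0$. For $S\subseteq S^+\cup S^-$ and a time horizon $\theta$, let $o^\theta(S)$ be the maximum amount of flow that can be sent over time from the sources in $S^+\cap S$ to the sinks in $S^-\setminus S$ within time horizon $\theta$ (so $o^\theta(S)=0$ for $\theta<0$). Put $d^\theta(S):=o^\theta(S)-\sum_{v\in S}b(v)$ and $d(\theta):=\min_{S\subseteq S^+\cup S^-}d^\theta(S)$, and let $\operatorname{cut}^\theta(S)$ be the left-hand derivative of the piecewise linear function $t\mapsto d^t(S)$ at $t=\theta$. A breakpoint of $t\mapsto d^t(S)$ is a point $t\ge 0$ at which its slope changes ($0$ included if the slope to the right of $0$ is positive). Let $J:=\{2^0,2^1,\dots,2^{M}\}$ with $M:=\lceil\log_2(k^2/4)\rceil$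 ($M:=0$ if $k\le 1$). The Generalized Discrete Newton Algorithm starts with $i=0$, $\theta_0=0$ and, while $d(\theta_i)<0$, performs iteration $i$: it chooses a minimizer $S_i\subseteq S^+\cup S^-$ of $S\mapsto d^{\theta_i}(S)$, sets $\theta_i':=\min\{\theta\ge 0: d^\theta(S_i)=0\}$ and $$\theta_{i+1}:=\max\Bigl(\{\theta_i'\}\cup\Bigl\{\theta=\theta_i'+j\cdot\tfrac{-d(\theta_i')}{\operatorname{cut}^{\theta_i'}(S_i)} : d(\theta)<0,\ j\in J\Bigr\}\Bigr),$$ and increases $i$ by one. Let $I$ be the set of iterations of a run. For $i\in I$ let $j_i:=0$ if $\theta_{i+1}=\theta_i'$, and otherwise let $j_i\in J$ be the $j$ for which the maximum is attained. Let $I^1:=\{i\in I: j_i=2^{M}\}$ and $$I^2:=\{i\in I\setminus I^1:\ \theta\mapsto d^\theta(S)\text{ has a breakpoint in }[\theta_i,\theta_{i+1}]\text{ for some }S\subseteq S^+\cup S^-\}.$$ Then $|I^2|\in O(m\log m)$. Precisely, there is an absolute constant $C$ such that for every instance and every run of the algorithm (with any choice of the minimizers $S_i$), the set $I^2$ is finite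 and $|I^2|\le C\,m\log\max\{m,2\}$. -/

import Mathlib

open MeasureTheory

noncomputable section

/-- A flow over time network: a finite directed (multi)graph with arcs `A` and nodes `V`, real
nonnegative capacities and transit times, and disjoint sets of sources and sinks. -/
structure FlowNetwork (V A : Type*) where
  src : A → V
  tgt : A → V
  cap : A → ℝ
  cap_nonneg : ∀ a, 0 ≤ cap a
  transit : A → ℝ
  transit_nonneg : ∀ a, 0 ≤ transit a
  sources : Finset V
  sinks : Finset V
  disjoint : Disjoint sources sinks

namespace FlowNetwork

variable {V A : Type*} [DecidableEq V] [Fintype A]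

/-- The excess of node `v` at time `t`: the flow that has arrived at `v` until time `t` minus the
flow that has left `v` until time `t`. Here `f a s` is the rate at which flow enters arc `a` at
time `s`. -/
def excess (N : FlowNetwork V A) (f : A → ℝ → ℝ) (v : V) (t : ℝ) : ℝ :=
  (∑ a with N.tgt a = v, ∫ s in (0 : ℝ)..(t - N.transit a), f a s)
    - ∑ a with N.src a = v, ∫ s in (0 : ℝ)..t, f a s

/-- `f` is a flow over time with time horizon `θ` that sends flow from the nodes in `X` to the
nodes in `Y`. Flow may only travel within the time interval `[0, θ]`. -/
structure IsFlowOverTime (N : FlowNetwork V A) (X Y : Finset V) (θ : ℝ) (f : A → ℝ → ℝ) :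
    Prop where
  measurable : ∀ a, Measurable (f a)
  nonneg : ∀ a t, 0 ≤ f a t
  le_cap : ∀ a t, f a t ≤ N.cap a
  eq_zero : ∀ a t, t ∉ Set.Ico 0 (θ - N.transit a) → f a t = 0
  conservation : ∀ v, v ∉ X → v ∉ Y → ∀ t, N.excess f v t = 0
  excess_nonpos : ∀ v ∈ X, ∀ t, N.excess f v t ≤ 0
  excess_nonneg : ∀ v ∈ Y, ∀ t, 0 ≤ N.excess f v t

/-- The maximum amount of flow that can be sent from the nodes in `X` to the nodes in `Y` within
time horizon `θ`. The set of attainable values contains `0` (zero flow) and is bounded. -/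
def maxFlowOverTime (N : FlowNetwork V A) (X Y : Finset V) (θ : ℝ) : ℝ :=
  sSup {r : ℝ | ∃ f, N.IsFlowOverTime X Y θ f ∧ r = ∑ v ∈ Y, N.excess f v θ}

/-- The set of terminals. -/
def terminals (N : FlowNetwork V A) : Finset V := N.sources ∪ N.sinks

/-- `o^θ(S)`: the maximum amount of flow that can be sent from the sources in `S` to the sinks
outside of `S` within time horizon `θ`. -/
def outFlow (N : FlowNetwork V A) (θ : ℝ) (S : Finset V) : ℝ :=
  N.maxFlowOverTime (N.sources ∩ S) (N.sinks \ S) θ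

end FlowNetwork

/-- An instance of the Quickest Transshipment Problem: a flow over time network together with
balanced supplies and demands. (The values of `b` outside of the terminals are never used.) -/
structure TransshipmentInstance (V A : Type*) [DecidableEq V] extends FlowNetwork V A where
  b : V → ℝ
  b_nonneg : ∀ v ∈ sources, 0 ≤ b v
  b_nonpos : ∀ v ∈ sinks, b v ≤ 0
  b_sum : ∑ v ∈ sources ∪ sinks, b v = 0

namespace TransshipmentInstance

variable {V A : Type*} [DecidableEq V] [Fintype A]

/-- `d^θ(S) = o^θ(S) - b(S)`. -/
def d (P : TransshipmentInstance V A) (θ : ℝ) (S : Finset V) : ℝ :=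
  P.outFlow θ S - ∑ v ∈ S, P.b v

/-- `d(θ)`: the minimum of `d^θ(S)` over all sets `S` of terminals. -/
def dMin (P : TransshipmentInstance V A) (θ : ℝ) : ℝ :=
  P.terminals.powerset.inf' ⟨∅, Finset.empty_mem_powerset _⟩ (P.d θ)

/-- `cut^θ(S)`: the left-hand derivative of `θ ↦ d^θ(S)`. -/
def cut (P : TransshipmentInstance V A) (θ : ℝ) (S : Finset V) : ℝ :=
  derivWithin (fun t => P.d t S) (Set.Iic θ) θ

/-- `r ≥ 0` is a breakpoint of the piecewise linear curve `θ ↦ d^θ(S)`: its slope changes at `r`.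
As no flow can be sent within a negative time horizon, the slope to the left of `0` is `0`; hence
`0` counts as a breakpoint if the curve starts with positive slope. -/
def IsBreakpoint (P : TransshipmentInstance V A) (S : Finset V) (r : ℝ) : Prop :=
  0 ≤ r ∧ ¬ DifferentiableAt ℝ (fun t => P.d t S) r

/-- The exponent `⌈log₂(k²/4)⌉` of the longest jump, where `k` is the number of terminals. (For
`k ≤ 1` it is `0`; in that case all supplies vanish and the algorithm performs no iteration.) -/
def maxExp (P : TransshipmentInstance V A) : ℕ :=
  ⌈Real.logb 2 ((P.terminals.card : ℝ) ^ 2 / 4)⌉₊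

/-- The set `J = {2^0, 2^1, …, 2^⌈log₂(k²/4)⌉}` of jump factors. -/
def jumps (P : TransshipmentInstance V A) : Set ℝ :=
  {j | ∃ e : ℕ, e ≤ P.maxExp ∧ j = 2 ^ e}

/-- The time `θ' + j * (-d(θ')) / cut^θ'(S)`. -/
def jumpTime (P : TransshipmentInstance V A) (θ' : ℝ) (S : Finset V) (j : ℝ) : ℝ :=
  θ' + j * (-P.dMin θ' / P.cut θ' S)

/-- The set `I` of iterations of the while-loop: the loop body is entered for the `i`-th time iff
the loop condition `d(θ_l) < 0` has been true for all `l ≤ i`. -/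
def iterations (P : TransshipmentInstance V A) (θ : ℕ → ℝ) : Set ℕ :=
  {i | ∀ l ≤ i, P.dMin (θ l) < 0}

/-- The sequences `θ_i`, `θ'_i`, `S_i` are those of a run of the Generalized Discrete Newton
Algorithm, for some choice of the minimizers `S_i`. Only the values belonging to iterations (and
`θ_i` on exit from the loop) matter. -/
structure IsRun (P : TransshipmentInstance V A) (θ θ' : ℕ → ℝ) (S : ℕ → Finset V) : Prop where
  start : θ 0 = 0
  subset_terminals : ∀ i ∈ P.iterations θ, S i ⊆ P.terminals
  minimizer : ∀ i ∈ P.iterations θ, P.d (θ i) (S i) = P.dMin (θ i)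
  first_update : ∀ i ∈ P.iterations θ, IsLeast {t | 0 ≤ t ∧ P.d t (S i) = 0} (θ' i)
  second_update : ∀ i ∈ P.iterations θ,
    IsGreatest ({θ' i} ∪ {t | P.dMin t < 0 ∧ ∃ j ∈ P.jumps, t = P.jumpTime (θ' i) (S i) j})
      (θ (i + 1))

/-- `j_i = j`: either the second update does not move `θ'_i` and `j = 0`, or it moves it by the
jump belonging to `j ∈ J`. -/
def HasJump (P : TransshipmentInstance V A) (θ θ' : ℕ → ℝ) (S : ℕ → Finset V) (i : ℕ) (j : ℝ) :
    Prop :=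
  (θ (i + 1) = θ' i ∧ j = 0) ∨
    (θ (i + 1) ≠ θ' i ∧ j ∈ P.jumps ∧ θ (i + 1) = P.jumpTime (θ' i) (S i) j)

/-- The iterations with the longest possible jump. -/
def I1 (P : TransshipmentInstance V A) (θ θ' : ℕ → ℝ) (S : ℕ → Finset V) : Set ℕ :=
  {i ∈ P.iterations θ | P.HasJump θ θ' S i (2 ^ P.maxExp)}

/-- The iterations outside of `I1` that move across a breakpoint. -/
def I2 (P : TransshipmentInstance V A) (θ θ' : ℕ → ℝ) (S : ℕ → Finset V) : Set ℕ :=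
  {i ∈ P.iterations θ \ P.I1 θ θ' S |
    ∃ T ⊆ P.terminals, ∃ r ∈ Set.Icc (θ i) (θ (i + 1)), P.IsBreakpoint T r}

end TransshipmentInstance

end

/-!
The bound rests on two facts: an iteration outside of `I1` at least halves the distance of `θ i` to
the first zero `θ*` of `d`, and all breakpoints are signed sums `∑ ε a * τ a` with coefficients in
`{-1, 0, 1}`. Only few signed sums can approach `θ*` geometrically.

*Halving* (`TransshipmentInstance.IsRun.exists_zero_near`). For fixed `S` the function `d^θ(S)` is
convex and nondecreasing in `θ ≥ 0`. Put `δ = -d(θ' i) / cut`. If the jump `j < 2 ^ M` is taken,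
then the jump `2 * j` belongs to `J` and leads to a zero of `d`, so `θ* ≤ θ' i + 2 * j * δ`. If no
jump is taken, then `θ* ≤ θ' i + δ`, and `δ ≤ θ' i - θ i` by convexity. In both cases
`θ* - θ (i + 1) ≤ θ (i + 1) - θ i`.

*Breakpoints* (`FlowNetwork.differentiableAt_maxFlowOverTime`). The maximum flow over time equals
the minimum capacity `∑ u a * max (π (tgt a) - π (src a) - τ a) 0` of a cut over time, where the
potential `π` is `0` on the sources and `t` on the sinks. Convexity and monotonicity in `t`
follow by mixing and truncating potentials. If `t` is not a signed sum, then no path of tight arcs joins a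
source to a sink; the part of `π` that is rigidly linked to the sinks can be shifted with `t`, which
bounds the convex function from above by an affine function touching it.

*Duality.* Weak duality is a computation with the excesses of the nodes `v` at the times `π v`. For
strong duality, the temporally repeated flows along walks form a packing program, whose variables
are indexed by the walks of positive capacity that can be traversed in time. An optimal solution of its dual
(`exists_packing_dual`, from the Hahn–Banach theorem) prolongs the arcs so that the truncated
distances from the sources are a potential of the required capacity
(`FlowNetwork.exists_cutCost_le_maxFlowOverTime`).

*Counting* (`card_le_of_halving`). Choose a breakpoint in each iteration of `I2`, and take the
differences of every third one. They are combinations of the `τ a` with coefficients in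
`{-2, …, 2}`, and each exceeds the sum of all later ones. Hence the `2 ^ q` subset sums of `q`
differences are distinct, while only `(4 * q + 1) ^ m` coefficient vectors are available, which
gives `q = O(m log m)`.
-/

/-! ### Duality for packing linear programs -/

/-- Strong duality for the packing program `max c·x` subject to `M x ≤ u`, `x ≥ 0`: if `B`
bounds all primal values, then some dual feasible `z` has value at most `B`. The index set `ι` of the variables may be infinite; positivity of `u` serves as
Slater condition. -/
theorem exists_packing_dual {ι κ : Type*} [Fintype κ] (u : κ → ℝ) (hu : ∀ a, 0 < u a)
    (M : ι → κ → ℝ) (c : ι → ℝ) (B : ℝ)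
    (hB : ∀ x : ι →₀ ℝ, 0 ≤ x →
      (∀ a, Finsupp.linearCombination ℝ (fun i => M i a) x ≤ u a) →
        Finsupp.linearCombination ℝ c x ≤ B) :
    ∃ z : κ → ℝ, (∀ a, 0 ≤ z a) ∧ (∀ i, c i ≤ ∑ a, z a * M i a) ∧ ∑ a, u a * z a ≤ B := by
  classical
  -- the pairs (capacities, value) that some `x` meets with slack in every coordinate
  let K : Set ((κ → ℝ) × ℝ) := {p | ∃ x : ι →₀ ℝ, 0 ≤ x ∧
    (∀ a, Finsupp.linearCombination ℝ (fun i => M i a) x < p.1 a) ∧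
      p.2 < Finsupp.linearCombination ℝ c x}
  have hconv : Convex ℝ K := by
    rintro p ⟨x, hx, hxM, hxc⟩ q ⟨y, hy, hyM, hyc⟩ s t hs ht hst
    refine ⟨s • x + t • y, add_nonneg (smul_nonneg hs hx) (smul_nonneg ht hy), fun a => ?_, ?_⟩
    · have h1 := hxM a
      have h2 := hyM a
      simp only [map_add, map_smul, smul_eq_mul, Prod.fst_add, Prod.smul_fst, Pi.add_apply,
        Pi.smul_apply]
      rcases hs.eq_or_lt with rfl | hs'
      · have : t = 1 := by linarith
        subst this; simpa using h2
      · nlinarith [mul_lt_mul_of_pos_left h1 hs', mul_le_mul_of_nonneg_left h2.le ht]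
    · simp only [map_add, map_smul, smul_eq_mul, Prod.snd_add, Prod.smul_snd]
      rcases hs.eq_or_lt with rfl | hs'
      · have : t = 1 := by linarith
        subst this; simpa using hyc
      · nlinarith [mul_lt_mul_of_pos_left hxc hs', mul_le_mul_of_nonneg_left hyc.le ht]
  have hopen : IsOpen K := by
    have : K = ⋃ x : ι →₀ ℝ, ⋃ _ : 0 ≤ x,
        ((⋂ a, {p : (κ → ℝ) × ℝ | Finsupp.linearCombination ℝ (fun i => M i a) x < p.1 a}) ∩
          {p | p.2 < Finsupp.linearCombination ℝ c x}) := by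
      ext p
      simp only [K, Set.mem_ofPred_eq, Set.mem_iUnion, Set.mem_inter_iff, Set.mem_iInter,
        exists_prop]
    rw [this]
    refine isOpen_iUnion fun x => isOpen_iUnion fun _ => IsOpen.inter ?_ ?_
    · exact isOpen_iInter_of_finite fun a => isOpen_lt continuous_const (by fun_prop)
    · exact isOpen_lt (by fun_prop) continuous_const
  have hnot : (u, B) ∉ K := by
    rintro ⟨x, hx, hxM, hxc⟩
    exact absurd (hB x hx fun a => (hxM a).le) (not_le.2 hxc)
  obtain ⟨f, hf⟩ := geometric_hahn_banach_open_point hconv hopen hnot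
  set w : κ → ℝ := fun a => f (Pi.single a 1, 0) with hw
  set l : ℝ := f (0, 1) with hl
  have hrep : ∀ y r, f (y, r) = ∑ a, y a * w a + r * l := by
    intro y r
    have : ((y, r) : (κ → ℝ) × ℝ) =
        ∑ a, y a • ((Pi.single a 1, 0) : (κ → ℝ) × ℝ) + r • (0, 1) := by
      ext b
      · simp [Prod.fst_sum, Finset.sum_apply, Pi.single_apply]
      · simp [Prod.snd_sum]
    simp only [this, map_add, map_sum, map_smul, smul_eq_mul, hw, hl]
  -- an affine function that is bounded above on a ray does not increase along it
  have harch : ∀ {α β γ : ℝ}, (∀ s : ℝ, 0 ≤ s → α + s * β < γ) → β ≤ 0 := by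
    intro α β γ h
    by_contra! hβ
    have h0 := h 0 le_rfl
    have := h ((γ - α) / β) (div_nonneg (by linarith) hβ.le)
    rw [div_mul_cancel₀ _ hβ.ne'] at this
    linarith
  have hwneg : ∀ a, w a ≤ 0 := by
    intro a
    refine harch (α := f (1, -1)) (γ := f (u, B)) fun s hs => ?_
    have : f (1 + s • Pi.single a 1, -1) < f (u, B) := by
      refine hf _ ⟨0, le_rfl, fun b => ?_, by simp⟩
      have : 0 ≤ s * (Pi.single a 1 : κ → ℝ) b := by
        by_cases h : b = a
        · subst h; simpa using hs
        · simp [h]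
      simp only [map_zero, Pi.add_apply, Pi.one_apply, Pi.smul_apply, smul_eq_mul]
      linarith
    have e : ((1 + s • Pi.single a 1, -1) : (κ → ℝ) × ℝ) = (1, -1) + s • (Pi.single a 1, 0) := by
      simp
    rwa [e, map_add, map_smul, smul_eq_mul] at this
  have hlpos : 0 < l := by
    have h1 : f ((2⁻¹ : ℝ) • u, B - 1 - |B|) < f (u, B) := by
      refine hf _ ⟨0, le_rfl, fun b => ?_, ?_⟩
      · have := hu b
        simp only [map_zero, Pi.smul_apply, smul_eq_mul]
        linarith
      · have := le_abs_self B
        simp only [map_zero]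
        linarith
    rw [hrep, hrep] at h1
    have h2 : ∑ a, u a * w a ≤ ∑ a, ((2⁻¹ : ℝ) • u) a * w a := by
      refine Finset.sum_le_sum fun a _ => ?_
      have := mul_nonpos_of_nonneg_of_nonpos (hu a).le (hwneg a)
      simp only [Pi.smul_apply, smul_eq_mul]
      nlinarith
    have h3 := abs_nonneg B
    by_contra! h
    nlinarith
  have hmain : ∀ x : ι →₀ ℝ, 0 ≤ x →
      ∑ a, Finsupp.linearCombination ℝ (fun i => M i a) x * w a
        + Finsupp.linearCombination ℝ c x * l ≤ ∑ a, u a * w a + B * l := by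
    intro x hx
    have key : ∀ ε : ℝ, 0 < ε →
        ∑ a, Finsupp.linearCombination ℝ (fun i => M i a) x * w a
          + Finsupp.linearCombination ℝ c x * l + ε * (∑ a, w a - l)
            ≤ ∑ a, u a * w a + B * l := by
      intro ε hε
      have := hf (fun a => Finsupp.linearCombination ℝ (fun i => M i a) x + ε,
        Finsupp.linearCombination ℝ c x - ε) ⟨x, hx, fun a => by simpa using hε, by simpa using hε⟩
      rw [hrep, hrep] at this
      simp only [add_mul, Finset.sum_add_distrib, ← Finset.mul_sum] at this
      linarith
    refine le_of_forall_pos_le_add fun δ hδ => ?_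
    have hN : 0 ≤ |∑ a, w a - l| := abs_nonneg _
    have h1 := key (δ / (|∑ a, w a - l| + 1)) (by positivity)
    have h2 : -δ ≤ δ / (|∑ a, w a - l| + 1) * (∑ a, w a - l) := by
      have h3 : δ / (|∑ a, w a - l| + 1) * |∑ a, w a - l| ≤ δ := by
        rw [div_mul_eq_mul_div, div_le_iff₀ (by positivity)]
        nlinarith
      have h4 : 0 < δ / (|∑ a, w a - l| + 1) := by positivity
      nlinarith [neg_abs_le (∑ a, w a - l)]
    linarith
  refine ⟨fun a => -w a / l, fun a => div_nonneg (by linarith [hwneg a]) hlpos.le, fun i => ?_, ?_⟩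
  · have h : ∑ a, M i a * w a + c i * l ≤ 0 := by
      refine harch (α := 0) (γ := ∑ a, u a * w a + B * l + 1) fun s hs => ?_
      have := hmain (Finsupp.single i s) (by simpa using hs)
      simp only [Finsupp.linearCombination_single, smul_eq_mul, mul_assoc, ← Finset.mul_sum] at this
      linarith
    have e : ∑ a, -w a / l * M i a = -(∑ a, M i a * w a) / l := by
      rw [← Finset.sum_neg_distrib, Finset.sum_div]
      exact Finset.sum_congr rfl fun a _ => by ring
    rw [e, le_div_iff₀ hlpos]
    linarith
  · have h := hmain 0 le_rfl
    simp only [map_zero, zero_mul, Finset.sum_const_zero, zero_add] at h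
    have e : ∑ a, u a * (-w a / l) = -(∑ a, u a * w a) / l := by
      rw [← Finset.sum_neg_distrib, Finset.sum_div]
      exact Finset.sum_congr rfl fun a _ => by ring
    rw [e, div_le_iff₀ hlpos]
    linarith

/-! ### Convex functions of one variable -/

/-- A convex function that is bounded above by an affine function touching it at an interior point
is differentiable there. -/
theorem ConvexOn.differentiableAt_of_le_affine {s : Set ℝ} {g : ℝ → ℝ} {r c : ℝ}
    (hg : ConvexOn ℝ s g) (hs : s ∈ nhds r)
    (hle : ∀ᶠ h in nhds (0 : ℝ), g (r + h) ≤ g r + c * h) : DifferentiableAt ℝ g r := by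
  have hneg : Filter.Tendsto (fun h : ℝ => -h) (nhds 0) (nhds 0) := by
    simpa using (continuous_neg (G := ℝ)).tendsto 0
  have hadd : Filter.Tendsto (fun h : ℝ => r + h) (nhds 0) (nhds r) := by
    simpa using
      (continuous_const.add continuous_id).tendsto (x := (0 : ℝ)) (f := fun h : ℝ => r + h)
  -- convexity at the midpoint `r` turns the upper bound on one side into a lower bound on the other
  have heq : ∀ᶠ h in nhds (0 : ℝ), g (r + h) = g r + c * h := by
    filter_upwards [hle, hneg.eventually hle, hadd.eventually hs,
      (hadd.comp hneg).eventually hs] with h h1 h2 h3 h4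
    have h5 := hg.2 h3 h4 (by norm_num : (0 : ℝ) ≤ 1 / 2) (by norm_num : (0 : ℝ) ≤ 1 / 2)
      (by norm_num)
    have e : (1 / 2 : ℝ) • (r + h) +
        (1 / 2 : ℝ) • (((fun h : ℝ => r + h) ∘ fun h => -h) h) = r := by
      simp only [Function.comp, smul_eq_mul]; ring
    rw [e] at h5
    simp only [Function.comp, smul_eq_mul] at h5
    linarith
  have hsub : Filter.Tendsto (fun t : ℝ => t - r) (nhds r) (nhds 0) := by
    simpa using (continuous_id.sub continuous_const).tendsto (x := r) (f := fun t : ℝ => t - r)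
  have heq' : g =ᶠ[nhds r] fun t => g r + c * (t - r) := by
    filter_upwards [hsub.eventually heq] with t ht
    simpa using ht
  exact heq'.differentiableAt_iff.2 (by fun_prop)

/-! ### Geometrically decreasing integer combinations -/

/-- Superdecreasing positive reals have pairwise distinct subset sums. -/
theorem subset_sum_injective {q : ℕ} (w : Fin q → ℝ) (hpos : ∀ i, 0 < w i)
    (hdec : ∀ i, ∑ j ∈ Finset.Ioi i, w j < w i) :
    Function.Injective fun s : Finset (Fin q) => ∑ i ∈ s, w i := by
  have key : ∀ (s t : Finset (Fin q)) (i : Fin q), i ∈ s → i ∉ t → (∀ j < i, j ∈ s ↔ j ∈ t) →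
      ∑ j ∈ t, w j < ∑ j ∈ s, w j := by
    intro s t i his hit hlt
    have h1 : ∑ j ∈ s with j < i, w j + w i ≤ ∑ j ∈ s, w j := by
      rw [← Finset.sum_filter_add_sum_filter_not s (· < i)]
      gcongr
      exact Finset.single_le_sum (f := w) (fun j _ => (hpos j).le) (by simp [his])
    have h2 : ∑ j ∈ t, w j ≤ ∑ j ∈ t with j < i, w j + ∑ j ∈ Finset.Ioi i, w j := by
      rw [← Finset.sum_filter_add_sum_filter_not t (· < i)]
      gcongr
      · exact fun j _ _ => (hpos j).le
      intro j hj
      simp only [Finset.mem_filter, not_lt] at hj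
      exact Finset.mem_Ioi.2 (lt_of_le_of_ne hj.2 fun h => hit (h ▸ hj.1))
    have h3 : (t.filter (· < i)) = s.filter (· < i) := by
      ext j; simp only [Finset.mem_filter]
      exact ⟨fun h => ⟨(hlt j h.2).2 h.1, h.2⟩, fun h => ⟨(hlt j h.2).1 h.1, h.2⟩⟩
    rw [h3] at h2
    linarith [hdec i]
  intro s t hst
  by_contra hne
  have hne' : (symmDiff s t).Nonempty := by
    rw [Finset.nonempty_iff_ne_empty]
    intro h
    exact hne (symmDiff_eq_bot.1 h)
  set i := (symmDiff s t).min' hne' with hi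
  have hmem : i ∈ symmDiff s t := Finset.min'_mem _ _
  have hlt : ∀ j < i, j ∈ s ↔ j ∈ t := by
    intro j hj
    by_contra hcon
    have : j ∈ symmDiff s t := by
      rw [Finset.mem_symmDiff]; tauto
    exact absurd (Finset.min'_le _ _ this) (not_le.2 hj)
  simp only at hst
  rcases Finset.mem_symmDiff.1 hmem with ⟨h1, h2⟩ | ⟨h1, h2⟩
  · exact (key s t i h1 h2 hlt).ne' hst
  · exact (key t s i h1 h2 fun j hj => (hlt j hj).symm).ne hst

/-- A superdecreasing sequence of positive combinations of the `τ a` with integer coefficients of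
absolute value at most `2` has bounded length: its `2 ^ q` subset sums are distinct, yet their
coefficient vectors lie in a box with `(4 * q + 1) ^ m` integer points. -/
theorem two_pow_le_of_superdecreasing {A : Type*} [Fintype A] (τ : A → ℝ) {q : ℕ}
    (v : Fin q → A → ℤ) (hv : ∀ i a, |v i a| ≤ 2)
    (hpos : ∀ i, 0 < ∑ a, (v i a : ℝ) * τ a)
    (hdec : ∀ i, ∑ j ∈ Finset.Ioi i, ∑ a, (v j a : ℝ) * τ a < ∑ a, (v i a : ℝ) * τ a) :
    2 ^ q ≤ (4 * q + 1) ^ Fintype.card A := by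
  classical
  let F : Finset (Fin q) → A → ℤ := fun s a => ∑ i ∈ s, v i a
  have hinj : Function.Injective F := by
    intro s t h
    apply subset_sum_injective _ hpos hdec
    have e : ∀ s : Finset (Fin q), ∑ i ∈ s, ∑ a, (v i a : ℝ) * τ a = ∑ a, (F s a : ℝ) * τ a := by
      intro s
      rw [Finset.sum_comm]
      refine Finset.sum_congr rfl fun a _ => ?_
      simp [F, Finset.sum_mul]
    simp only [e, h]
  have hmaps : ∀ s ∈ (Finset.univ : Finset (Finset (Fin q))),
      F s ∈ Fintype.piFinset fun _ : A => Finset.Icc (-(2 * q : ℤ)) (2 * q) := by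
    intro s _
    rw [Fintype.mem_piFinset]
    intro a
    have h1 : |F s a| ≤ 2 * q := by
      calc |F s a| ≤ ∑ i ∈ s, |v i a| := Finset.abs_sum_le_sum_abs _ _
        _ ≤ ∑ i ∈ s, 2 := Finset.sum_le_sum fun i _ => hv i a
        _ = 2 * (s.card : ℤ) := by simp [mul_comm]
        _ ≤ 2 * q := by
          have : s.card ≤ q := by simpa using Finset.card_le_univ s
          exact_mod_cast Nat.mul_le_mul_left 2 this
    exact Finset.mem_Icc.2 (abs_le.1 h1)
  have := Finset.card_le_card_of_injOn F hmaps hinj.injOn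
  have htoNat : ((2 * q + 1 + 2 * q : ℤ)).toNat = 4 * q + 1 := by omega
  simpa [Fintype.card_piFinset, htoNat] using this

namespace FlowNetwork

variable {V A : Type*} [DecidableEq V] [Fintype A]

/-! ### Cuts over time and weak duality -/

/-- The capacity of the cut over time given by the potential `π`: node `v` changes from the sink
side to the source side at time `π v`, so arc `a` crosses the cut during the time interval
`[π (src a), π (tgt a) - transit a)`. -/
noncomputable def cutCost (N : FlowNetwork V A) (π : V → ℝ) : ℝ :=
  ∑ a, N.cap a * max (π (N.tgt a) - π (N.src a) - N.transit a) 0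

/-- `π` is the potential of a cut over time separating `X` from `Y` with time horizon `t`. -/
def IsCutPotential (X Y : Finset V) (t : ℝ) (π : V → ℝ) : Prop :=
  (∀ v ∈ X, π v = 0) ∧ ∀ v ∈ Y, π v = t

theorem IsFlowOverTime.intervalIntegrable {N : FlowNetwork V A} {X Y : Finset V} {t : ℝ}
    {f : A → ℝ → ℝ} (hf : N.IsFlowOverTime X Y t f) (a : A) (p q : ℝ) :
    IntervalIntegrable (f a) volume p q := by
  refine (intervalIntegrable_const (c := N.cap a)).mono_fun
    (hf.measurable a).aestronglyMeasurable (Filter.Eventually.of_forall fun s => ?_)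
  change ‖f a s‖ ≤ ‖N.cap a‖
  rw [Real.norm_of_nonneg (hf.nonneg a s), Real.norm_of_nonneg (N.cap_nonneg a)]
  exact hf.le_cap a s

theorem IsFlowOverTime.integral_eq_zero_of_nonpos {N : FlowNetwork V A} {X Y : Finset V} {t : ℝ}
    {f : A → ℝ → ℝ} (hf : N.IsFlowOverTime X Y t f) (a : A) {s : ℝ} (hs : s ≤ 0) :
    ∫ y in (0 : ℝ)..s, f a y = 0 := by
  rw [intervalIntegral.integral_symm, neg_eq_zero, intervalIntegral.integral_of_le hs,
    ← integral_Ico_eq_integral_Ioc]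
  refine setIntegral_eq_zero_of_forall_eq_zero fun y hy => hf.eq_zero a y fun h => ?_
  exact absurd h.1 (not_le.2 hy.2)

theorem IsFlowOverTime.integral_le {N : FlowNetwork V A} {X Y : Finset V} {t : ℝ}
    {f : A → ℝ → ℝ} (hf : N.IsFlowOverTime X Y t f) (a : A) (p q : ℝ) :
    ∫ y in p..q, f a y ≤ N.cap a * max (q - p) 0 := by
  rcases le_total p q with h | h
  · rw [max_eq_left (by linarith)]
    calc ∫ y in p..q, f a y ≤ ∫ _ in p..q, N.cap a :=
          intervalIntegral.integral_mono h (hf.intervalIntegrable a p q)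
            intervalIntegrable_const fun y => hf.le_cap a y
      _ = N.cap a * (q - p) := by simp [mul_comm]
  · rw [max_eq_right (by linarith), mul_zero, intervalIntegral.integral_symm, neg_nonpos]
    exact intervalIntegral.integral_nonneg h fun y _ => hf.nonneg a y

/-- Weak duality: no flow over time sends more than the capacity of a cut over time. The value of
the flow is the sum over all nodes `v` of the excess of `v` at the time `π v`. -/
theorem IsFlowOverTime.value_le_cutCost [Fintype V] {N : FlowNetwork V A} {X Y : Finset V} {t : ℝ}
    {f : A → ℝ → ℝ} (hf : N.IsFlowOverTime X Y t f) {π : V → ℝ} (hπ : IsCutPotential X Y t π) :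
    ∑ v ∈ Y, N.excess f v t ≤ N.cutCost π := by
  have h1 : ∑ v ∈ Y, N.excess f v t = ∑ v, N.excess f v (π v) := by
    rw [← Finset.sum_subset (Finset.subset_univ Y)]
    · exact Finset.sum_congr rfl fun v hv => by rw [hπ.2 v hv]
    · intro v _ hvY
      by_cases hvX : v ∈ X
      · rw [hπ.1 v hvX, excess, Finset.sum_eq_zero, Finset.sum_eq_zero, sub_zero]
        · intro a _
          simp
        · intro a _
          exact hf.integral_eq_zero_of_nonpos a (by linarith [N.transit_nonneg a])
      · exact hf.conservation v hvX hvY _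
  have h2 : ∑ v, N.excess f v (π v) =
      ∑ a, ∫ y in π (N.src a)..(π (N.tgt a) - N.transit a), f a y := by
    simp only [excess, Finset.sum_sub_distrib]
    have ht : ∑ v, ∑ a with N.tgt a = v, ∫ s in (0 : ℝ)..(π v - N.transit a), f a s =
        ∑ a, ∫ s in (0 : ℝ)..(π (N.tgt a) - N.transit a), f a s := by
      rw [← Finset.sum_fiberwise (s := Finset.univ) (g := N.tgt)]
      refine Finset.sum_congr rfl fun v _ => Finset.sum_congr rfl fun a ha => ?_
      rw [(Finset.mem_filter.1 ha).2]
    have hs : ∑ v, ∑ a with N.src a = v, ∫ s in (0 : ℝ)..(π v), f a s =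
        ∑ a, ∫ s in (0 : ℝ)..(π (N.src a)), f a s := by
      rw [← Finset.sum_fiberwise (s := Finset.univ) (g := N.src)]
      refine Finset.sum_congr rfl fun v _ => Finset.sum_congr rfl fun a ha => ?_
      rw [(Finset.mem_filter.1 ha).2]
    rw [ht, hs, ← Finset.sum_sub_distrib]
    refine Finset.sum_congr rfl fun a _ => ?_
    exact intervalIntegral.integral_interval_sub_left (hf.intervalIntegrable a _ _)
      (hf.intervalIntegrable a _ _)
  rw [h1, h2]
  refine Finset.sum_le_sum fun a _ => (hf.integral_le a _ _).trans_eq ?_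
  congr 2
  ring

omit [DecidableEq V] in
theorem cutCost_nonneg (N : FlowNetwork V A) (π : V → ℝ) : 0 ≤ N.cutCost π :=
  Finset.sum_nonneg fun a _ => mul_nonneg (N.cap_nonneg a) (le_max_right _ _)

theorem maxFlowOverTime_le_cutCost [Fintype V] (N : FlowNetwork V A) {X Y : Finset V} {t : ℝ}
    {π : V → ℝ} (hπ : IsCutPotential X Y t π) :
    N.maxFlowOverTime X Y t ≤ N.cutCost π := by
  refine Real.sSup_le ?_ (N.cutCost_nonneg π)
  rintro r ⟨f, hf, rfl⟩
  exact hf.value_le_cutCost hπ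

theorem exists_isCutPotential {X Y : Finset V} (hXY : Disjoint X Y) (t : ℝ) :
    ∃ π : V → ℝ, IsCutPotential X Y t π := by
  refine ⟨fun v => if v ∈ X then 0 else t, fun v hv => by simp [hv], fun v hv => ?_⟩
  simp [Finset.disjoint_right.1 hXY hv]

theorem IsFlowOverTime.value_le_maxFlowOverTime [Fintype V] {N : FlowNetwork V A} {X Y : Finset V}
    (hXY : Disjoint X Y) {t : ℝ} {f : A → ℝ → ℝ} (hf : N.IsFlowOverTime X Y t f) :
    ∑ v ∈ Y, N.excess f v t ≤ N.maxFlowOverTime X Y t := by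
  obtain ⟨π, hπ⟩ := exists_isCutPotential hXY t
  refine le_csSup ⟨N.cutCost π, ?_⟩ ⟨f, hf, rfl⟩
  rintro r ⟨g, hg, rfl⟩
  exact hg.value_le_cutCost hπ

/-! ### Walks and temporally repeated flows -/

/-- `N.IsWalk x L v`: the list of arcs `L`, read from its end to its head, is a walk from `x`
to `v`. -/
inductive IsWalk (N : FlowNetwork V A) (x : V) : List A → V → Prop
  | nil : IsWalk N x [] x
  | cons {L : List A} (a : A) : IsWalk N x L (N.src a) → IsWalk N x (a :: L) (N.tgt a)

/-- The sum of the weights `w` of the arcs of a walk, with multiplicity. -/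
def walkLength (w : A → ℝ) (L : List A) : ℝ := (L.map w).sum

omit [Fintype A] in
theorem walkLength_nonneg {w : A → ℝ} (hw : ∀ a, 0 ≤ w a) (L : List A) : 0 ≤ walkLength w L :=
  List.sum_nonneg (by simpa using fun a _ => hw a)

omit [Fintype A] in
@[simp] theorem walkLength_cons (w : A → ℝ) (a : A) (L : List A) :
    walkLength w (a :: L) = w a + walkLength w L := by simp [walkLength]

/-- The inflow rate that is `1` during the time interval `[0, ℓ)`. -/
noncomputable def unitPulse (ℓ s : ℝ) : ℝ := (Set.Ico 0 ℓ).indicator 1 s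

theorem unitPulse_nonneg (ℓ s : ℝ) : 0 ≤ unitPulse ℓ s :=
  Set.indicator_nonneg (fun _ _ => zero_le_one) s

theorem unitPulse_le_one (ℓ s : ℝ) : unitPulse ℓ s ≤ 1 :=
  Set.indicator_le' (g := 1) (fun _ _ => le_rfl) (fun _ _ => zero_le_one) s

theorem measurable_unitPulse (ℓ : ℝ) : Measurable (unitPulse ℓ) :=
  measurable_one.indicator measurableSet_Ico

theorem intervalIntegrable_unitPulse (ℓ p q : ℝ) :
    IntervalIntegrable (unitPulse ℓ) volume p q := by
  refine (intervalIntegrable_const (c := (1 : ℝ))).mono_fun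
    (measurable_unitPulse ℓ).aestronglyMeasurable (Filter.Eventually.of_forall fun s => ?_)
  change ‖unitPulse ℓ s‖ ≤ ‖(1 : ℝ)‖
  rw [Real.norm_of_nonneg (unitPulse_nonneg ℓ s), norm_one]
  exact unitPulse_le_one ℓ s

theorem integral_unitPulse_of_nonpos (ℓ : ℝ) {s : ℝ} (hs : s ≤ 0) :
    ∫ y in (0 : ℝ)..s, unitPulse ℓ y = 0 := by
  rw [intervalIntegral.integral_symm, neg_eq_zero, intervalIntegral.integral_of_le hs,
    ← integral_Ico_eq_integral_Ioc]
  refine setIntegral_eq_zero_of_forall_eq_zero fun y hy => Set.indicator_of_notMem (fun h => ?_) _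
  exact absurd h.1 (not_le.2 hy.2)

theorem integral_unitPulse_nonneg (ℓ s : ℝ) : 0 ≤ ∫ y in (0 : ℝ)..s, unitPulse ℓ y := by
  rcases le_total s 0 with hs | hs
  · rw [integral_unitPulse_of_nonpos ℓ hs]
  · exact intervalIntegral.integral_nonneg hs fun y _ => unitPulse_nonneg ℓ y

theorem integral_unitPulse_self {ℓ : ℝ} (hℓ : 0 ≤ ℓ) :
    ∫ y in (0 : ℝ)..ℓ, unitPulse ℓ y = ℓ := by
  rw [intervalIntegral.integral_of_le hℓ, ← integral_Ico_eq_integral_Ioc]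
  simp [unitPulse, setIntegral_indicator, hℓ]

theorem integral_unitPulse_sub (ℓ s : ℝ) {o : ℝ} (ho : 0 ≤ o) :
    ∫ y in (0 : ℝ)..s, unitPulse ℓ (y - o) = ∫ y in (0 : ℝ)..(s - o), unitPulse ℓ y := by
  rw [intervalIntegral.integral_comp_sub_right (unitPulse ℓ) o, zero_sub,
    ← intervalIntegral.integral_interval_sub_left (a := 0)
      (intervalIntegrable_unitPulse ℓ _ _) (intervalIntegrable_unitPulse ℓ _ _),
    integral_unitPulse_of_nonpos ℓ (s := -o) (by linarith), sub_zero]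

open Classical in
/-- The flow over time that enters a walk `L` at unit rate during the time interval `[0, ℓ)` and
travels along `L` without waiting. -/
noncomputable def walkFlow (N : FlowNetwork V A) (ℓ : ℝ) : List A → A → ℝ → ℝ
  | [] => fun _ _ => 0
  | a :: L => fun b s =>
      (if b = a then unitPulse ℓ (s - walkLength N.transit L) else 0) + N.walkFlow ℓ L b s

section WalkFlow

variable (N : FlowNetwork V A) (ℓ : ℝ)

omit [DecidableEq V] [Fintype A] in
theorem measurable_walkFlow (L : List A) (b : A) : Measurable (N.walkFlow ℓ L b) := by
  induction L with
  | nil => exact measurable_const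
  | cons a L ih =>
    refine Measurable.add ?_ ih
    split_ifs
    · exact (measurable_unitPulse ℓ).comp (measurable_id.sub_const _)
    · exact measurable_const

omit [DecidableEq V] [Fintype A] in
theorem walkFlow_nonneg (L : List A) (b : A) (s : ℝ) : 0 ≤ N.walkFlow ℓ L b s := by
  induction L with
  | nil => exact le_rfl
  | cons a L ih =>
    refine add_nonneg ?_ ih
    split_ifs
    · exact unitPulse_nonneg _ _
    · exact le_rfl

omit [DecidableEq V] [Fintype A] in
open Classical in
theorem walkFlow_le_count (L : List A) (b : A) (s : ℝ) : N.walkFlow ℓ L b s ≤ L.count b := by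
  induction L with
  | nil => simp [walkFlow]
  | cons a L ih =>
    rw [List.count_cons, Nat.cast_add]
    refine (add_le_add ?_ ih).trans_eq (add_comm _ _)
    by_cases h : b = a
    · simpa [h] using unitPulse_le_one _ _
    · simp [h, Ne.symm h]

omit [DecidableEq V] [Fintype A] in
theorem intervalIntegrable_walkFlow (L : List A) (b : A) (p q : ℝ) :
    IntervalIntegrable (N.walkFlow ℓ L b) volume p q := by
  classical
  refine (intervalIntegrable_const (c := (L.count b : ℝ))).mono_fun
    (N.measurable_walkFlow ℓ L b).aestronglyMeasurable (Filter.Eventually.of_forall fun s => ?_)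
  change ‖N.walkFlow ℓ L b s‖ ≤ ‖(L.count b : ℝ)‖
  rw [Real.norm_of_nonneg (N.walkFlow_nonneg ℓ L b s), Real.norm_of_nonneg (by positivity)]
  convert N.walkFlow_le_count ℓ L b s

omit [DecidableEq V] [Fintype A] in
theorem walkFlow_eq_zero (L : List A) (b : A) {t s : ℝ} (ht : walkLength N.transit L + ℓ ≤ t)
    (hs : s ∉ Set.Ico 0 (t - N.transit b)) : N.walkFlow ℓ L b s = 0 := by
  classical
  induction L with
  | nil => rfl
  | cons a L ih =>
    rw [walkLength_cons] at ht
    change (if b = a then unitPulse ℓ (s - walkLength N.transit L) else 0) + N.walkFlow ℓ L b s = 0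
    rw [ih (by linarith [N.transit_nonneg a]), add_zero]
    split_ifs with h
    · subst h
      refine Set.indicator_of_notMem (fun hmem => hs ⟨?_, ?_⟩) _
      · linarith [hmem.1, walkLength_nonneg N.transit_nonneg L]
      · linarith [hmem.2]
    · rfl

theorem excess_add {f g : A → ℝ → ℝ} (hf : ∀ a p q, IntervalIntegrable (f a) volume p q)
    (hg : ∀ a p q, IntervalIntegrable (g a) volume p q) (v : V) (t : ℝ) :
    N.excess (fun a s => f a s + g a s) v t = N.excess f v t + N.excess g v t := by
  simp only [excess, intervalIntegral.integral_add (hf _ _ _) (hg _ _ _), Finset.sum_add_distrib]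
  ring

theorem excess_sum {ι : Type*} (s : Finset ι) (c : ι → ℝ) {f : ι → A → ℝ → ℝ}
    (hf : ∀ i a p q, IntervalIntegrable (f i a) volume p q) (v : V) (t : ℝ) :
    N.excess (fun a y => ∑ i ∈ s, c i * f i a y) v t = ∑ i ∈ s, c i * N.excess (f i) v t := by
  have h : ∀ a p q, ∫ y in p..q, ∑ i ∈ s, c i * f i a y = ∑ i ∈ s, c i * ∫ y in p..q, f i a y := by
    intro a p q
    rw [intervalIntegral.integral_finsetSum fun i _ => (hf i a p q).const_mul _]
    simp
  simp only [excess, h, mul_sub, Finset.sum_sub_distrib, Finset.mul_sum]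
  congr 1 <;> exact Finset.sum_comm

/-- Inside of a walk the flow is passed on instantaneously, so only the ends have an excess. -/
theorem excess_walkFlow {x v : V} {L : List A} (hL : N.IsWalk x L v) (w : V) (s : ℝ) :
    N.excess (N.walkFlow ℓ L) w s =
      (if v = w then ∫ y in (0 : ℝ)..(s - walkLength N.transit L), unitPulse ℓ y else 0)
        - (if x = w then ∫ y in (0 : ℝ)..s, unitPulse ℓ y else 0) := by
  classical
  induction hL with
  | nil => simp [excess, walkFlow, walkLength]
  | @cons L a _ ih =>
    have hint : ∀ b p q, IntervalIntegrable
        ((fun b s => if b = a then unitPulse ℓ (s - walkLength N.transit L) else 0) b)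
          volume p q := by
      intro b p q
      by_cases h : b = a
      · simpa [h] using (intervalIntegrable_unitPulse ℓ (p - walkLength N.transit L)
          (q - walkLength N.transit L)).comp_sub_right (walkLength N.transit L)
      · simp [h]
    have hpulse : N.excess
        (fun b s => if b = a then unitPulse ℓ (s - walkLength N.transit L) else 0) w s =
        (if N.tgt a = w then
          ∫ y in (0 : ℝ)..(s - N.transit a - walkLength N.transit L), unitPulse ℓ y else 0)
        - (if N.src a = w then
          ∫ y in (0 : ℝ)..(s - walkLength N.transit L), unitPulse ℓ y else 0) := by
      have h : ∀ b q, ∫ y in (0 : ℝ)..q,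
          (if b = a then unitPulse ℓ (y - walkLength N.transit L) else 0) =
          if b = a then ∫ y in (0 : ℝ)..(q - walkLength N.transit L), unitPulse ℓ y else 0 := by
        intro b q
        split_ifs
        · exact integral_unitPulse_sub ℓ q (walkLength_nonneg N.transit_nonneg L)
        · simp
      simp only [excess, h, Finset.sum_filter]
      congr 1
      · rw [Finset.sum_eq_single a (fun b _ hb => by simp [hb]) (by simp)]
        simp
      · rw [Finset.sum_eq_single a (fun b _ hb => by simp [hb]) (by simp)]
        simp
    have e : N.walkFlow ℓ (a :: L) = fun b s =>
        (fun b s => if b = a then unitPulse ℓ (s - walkLength N.transit L) else 0) b s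
          + N.walkFlow ℓ L b s := by
      funext b s
      rw [walkFlow]
    rw [e, N.excess_add hint (N.intervalIntegrable_walkFlow ℓ L), hpulse, ih, walkLength_cons,
      sub_sub]
    ring

end WalkFlow

/-! ### Strong duality -/

omit [Fintype A] in
theorem walkLength_add (w z : A → ℝ) (L : List A) :
    walkLength (fun a => w a + z a) L = walkLength w L + walkLength z L := by
  induction L with
  | nil => simp [walkLength]
  | cons a L ih => rw [walkLength_cons, walkLength_cons, walkLength_cons, ih]; ring

open Classical in
theorem sum_mul_count (z : A → ℝ) (L : List A) :
    ∑ a, z a * (L.count a : ℝ) = walkLength z L := by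
  induction L with
  | nil => simp [walkLength]
  | cons a L ih =>
    simp [List.count_cons, mul_add, Finset.sum_add_distrib, ih, add_comm]

omit [Fintype A] in
theorem le_walkLength_of_mem {w : A → ℝ} (hw : ∀ a, 0 ≤ w a) {a : A} {L : List A} (ha : a ∈ L) :
    w a ≤ walkLength w L :=
  List.single_le_sum (by simpa using fun b _ => hw b) _ (List.mem_map_of_mem ha)

section WalkPacking

variable (N : FlowNetwork V A) (X Y : Finset V) (t : ℝ)

/-- The walks of positive capacity from `X` to `Y` that can be traversed within time `t`. -/
abbrev TimelyWalk : Type _ :=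
  {L : List A // (∃ x ∈ X, ∃ y ∈ Y, N.IsWalk x L y) ∧ walkLength N.transit L ≤ t ∧
    ∀ a ∈ L, N.cap a ≠ 0}

/-- The temporally repeated flow that sends flow along the walk `L` at rate `x L` for as long as
it arrives before time `t`. -/
noncomputable def repeatedFlow (x : N.TimelyWalk X Y t →₀ ℝ) (a : A) (s : ℝ) : ℝ :=
  ∑ L ∈ x.support, x L * N.walkFlow (t - walkLength N.transit L.1) L.1 a s

variable {X Y t}

theorem excess_repeatedFlow (x : N.TimelyWalk X Y t →₀ ℝ) (v : V) (s : ℝ) :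
    N.excess (N.repeatedFlow X Y t x) v s = ∑ L ∈ x.support,
      x L * N.excess (N.walkFlow (t - walkLength N.transit L.1) L.1) v s :=
  N.excess_sum x.support x (fun L => N.intervalIntegrable_walkFlow _ L.1) v s

open Classical in
theorem isFlowOverTime_repeatedFlow (hXY : Disjoint X Y) {x : N.TimelyWalk X Y t →₀ ℝ} (hx : 0 ≤ x)
    (hcap : ∀ a, N.cap a ≠ 0 → ∑ L ∈ x.support, x L * (L.1.count a : ℝ) ≤ N.cap a) :
    N.IsFlowOverTime X Y t (N.repeatedFlow X Y t x) where
  measurable a :=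
    Finset.measurable_sum _ fun L _ => (N.measurable_walkFlow _ L.1 a).const_mul _
  nonneg a s := Finset.sum_nonneg fun L _ => mul_nonneg (hx L) (N.walkFlow_nonneg _ L.1 a s)
  le_cap a s := by
    have h : N.repeatedFlow X Y t x a s ≤ ∑ L ∈ x.support, x L * (L.1.count a : ℝ) :=
      Finset.sum_le_sum fun L _ =>
        mul_le_mul_of_nonneg_left (N.walkFlow_le_count _ L.1 a s) (hx L)
    by_cases ha : N.cap a = 0
    · refine h.trans (Finset.sum_nonpos fun L _ => ?_ : _ ≤ (0 : ℝ)) |>.trans (N.cap_nonneg a)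
      rw [List.count_eq_zero.2 fun hmem => L.2.2.2 a hmem ha]
      simp
    · exact h.trans (hcap a ha)
  eq_zero a s hs := Finset.sum_eq_zero fun L _ => by
    rw [N.walkFlow_eq_zero _ L.1 a (by linarith) hs, mul_zero]
  conservation v hvX hvY s := by
    rw [excess_repeatedFlow]
    refine Finset.sum_eq_zero fun L _ => ?_
    obtain ⟨p, hp, q, hq, hL⟩ := L.2.1
    have h1 : q ≠ v := fun h => hvY (h ▸ hq)
    have h2 : p ≠ v := fun h => hvX (h ▸ hp)
    rw [N.excess_walkFlow _ hL, if_neg h1, if_neg h2]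
    simp
  excess_nonpos v hv s := by
    rw [excess_repeatedFlow]
    refine Finset.sum_nonpos fun L _ => mul_nonpos_of_nonneg_of_nonpos (hx L) ?_
    obtain ⟨p, hp, q, hq, hL⟩ := L.2.1
    have h1 : q ≠ v := fun h => Finset.disjoint_left.1 hXY hv (h ▸ hq)
    rw [N.excess_walkFlow _ hL, if_neg h1, zero_sub, neg_nonpos]
    split_ifs
    exacts [integral_unitPulse_nonneg _ _, le_rfl]
  excess_nonneg v hv s := by
    rw [excess_repeatedFlow]
    refine Finset.sum_nonneg fun L _ => mul_nonneg (hx L) ?_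
    obtain ⟨p, hp, q, hq, hL⟩ := L.2.1
    have h2 : p ≠ v := fun h => Finset.disjoint_left.1 hXY hp (h ▸ hv)
    rw [N.excess_walkFlow _ hL, if_neg h2, sub_zero]
    split_ifs
    exacts [integral_unitPulse_nonneg _ _, le_rfl]

theorem value_repeatedFlow (hXY : Disjoint X Y) (x : N.TimelyWalk X Y t →₀ ℝ) :
    ∑ v ∈ Y, N.excess (N.repeatedFlow X Y t x) v t =
      ∑ L ∈ x.support, x L * (t - walkLength N.transit L.1) := by
  simp only [excess_repeatedFlow]
  rw [Finset.sum_comm]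
  refine Finset.sum_congr rfl fun L _ => ?_
  rw [← Finset.mul_sum]
  obtain ⟨p, hp, q, hq, hL⟩ := L.2.1
  simp only [N.excess_walkFlow _ hL, Finset.sum_sub_distrib, Finset.sum_ite_eq, if_pos hq,
    if_neg (Finset.disjoint_left.1 hXY hp), sub_zero,
    integral_unitPulse_self (sub_nonneg.2 L.2.2.1)]

end WalkPacking

omit [DecidableEq V] [Fintype A] in
/-- Arc lengths that make every walk from `X` to `Y` at least `t` long yield a cut potential in
which neighbours differ by at most these lengths: the distance from `X`, truncated at `t`. -/
theorem exists_cutPotential_of_walkLength (N : FlowNetwork V A) {X Y : Finset V} {t : ℝ}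
    (ht : 0 ≤ t) {w : A → ℝ} (hw : ∀ a, 0 ≤ w a)
    (hlen : ∀ x ∈ X, ∀ y ∈ Y, ∀ L, N.IsWalk x L y → t ≤ walkLength w L) :
    ∃ π : V → ℝ, IsCutPotential X Y t π ∧ ∀ a, π (N.tgt a) - π (N.src a) ≤ w a := by
  let D : V → Set ℝ := fun v => {l | l = t ∨ ∃ x ∈ X, ∃ L, N.IsWalk x L v ∧ l = walkLength w L}
  have hmem : ∀ v, t ∈ D v := fun v => Or.inl rfl
  have hnonneg : ∀ v, ∀ l ∈ D v, 0 ≤ l := by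
    rintro v l (rfl | ⟨x, _, L, _, rfl⟩)
    exacts [ht, walkLength_nonneg hw L]
  have hbdd : ∀ v, BddBelow (D v) := fun v => ⟨0, fun l hl => hnonneg v l hl⟩
  refine ⟨fun v => sInf (D v), ⟨fun v hv => ?_, fun v hv => ?_⟩, fun a => ?_⟩
  · refine le_antisymm (csInf_le (hbdd v) ?_) (le_csInf ⟨t, hmem v⟩ (hnonneg v))
    exact Or.inr ⟨v, hv, [], IsWalk.nil, by simp [walkLength]⟩
  · refine le_antisymm (csInf_le (hbdd v) (hmem v)) (le_csInf ⟨t, hmem v⟩ ?_)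
    rintro l (rfl | ⟨x, hx, L, hL, rfl⟩)
    exacts [le_rfl, hlen x hx v hv L hL]
  · rw [sub_le_iff_le_add, ← sub_le_iff_le_add']
    refine le_csInf ⟨t, hmem _⟩ ?_
    rintro l (rfl | ⟨x, hx, L, hL, rfl⟩)
    · have := csInf_le (hbdd (N.tgt a)) (hmem _)
      linarith [hw a]
    · have := csInf_le (hbdd (N.tgt a)) (Or.inr ⟨x, hx, a :: L, hL.cons a, rfl⟩)
      rw [walkLength_cons] at this
      linarith

/-- Strong duality: some cut over time has capacity at most the maximum flow over time. The cut
arises from an optimal dual solution of the packing program of the temporally repeated flows. -/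
theorem exists_cutCost_le_maxFlowOverTime [Fintype V] (N : FlowNetwork V A) {X Y : Finset V}
    (hXY : Disjoint X Y) {t : ℝ} (ht : 0 ≤ t) :
    ∃ π : V → ℝ, IsCutPotential X Y t π ∧ N.cutCost π ≤ N.maxFlowOverTime X Y t := by
  classical
  -- The walks in the packing program avoid the arcs of capacity zero, so the value given to their
  -- capacities is immaterial; `1` makes all capacities positive.
  obtain ⟨z, hz0, hz, hzcost⟩ := exists_packing_dual
    (fun a => if N.cap a = 0 then 1 else N.cap a)
    (fun a => by
      split_ifs with h
      exacts [one_pos, lt_of_le_of_ne (N.cap_nonneg a) (Ne.symm h)])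
    (fun (L : N.TimelyWalk X Y t) a => (L.1.count a : ℝ))
    (fun L => t - walkLength N.transit L.1) (N.maxFlowOverTime X Y t) (by
      intro x hx hcap
      have hflow := N.isFlowOverTime_repeatedFlow hXY hx fun a ha => by
        simpa [Finsupp.linearCombination_apply, Finsupp.sum, ha] using hcap a
      have := hflow.value_le_maxFlowOverTime hXY
      rw [N.value_repeatedFlow hXY] at this
      simpa [Finsupp.linearCombination_apply, Finsupp.sum] using this)
  -- arcs of capacity zero may be blocked for free
  let z' : A → ℝ := fun a => if N.cap a = 0 then t else z a
  have hz'0 : ∀ a, 0 ≤ z' a := by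
    intro a
    simp only [z']
    split_ifs
    exacts [ht, hz0 a]
  obtain ⟨π, hπ, hπw⟩ := N.exists_cutPotential_of_walkLength (X := X) (Y := Y) ht
    (w := fun a => N.transit a + z' a) (fun a => add_nonneg (N.transit_nonneg a) (hz'0 a)) (by
      intro x hx y hy L hL
      rw [walkLength_add]
      have h1 := walkLength_nonneg N.transit_nonneg L
      have h2 := walkLength_nonneg hz'0 L
      by_cases hblock : ∃ a ∈ L, N.cap a = 0
      · obtain ⟨a, haL, ha⟩ := hblock
        have := le_walkLength_of_mem hz'0 haL
        simp only [z', if_pos ha] at this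
        linarith
      · push Not at hblock
        by_cases hlong : walkLength N.transit L ≤ t
        · have := hz ⟨L, ⟨x, hx, y, hy, hL⟩, hlong, hblock⟩
          rw [sum_mul_count] at this
          have e : walkLength z L = walkLength z' L := by
            unfold walkLength
            congr 1
            exact List.map_congr_left fun a ha => by simp [z', hblock a ha]
          linarith
        · linarith)
  refine ⟨π, hπ, le_trans (Finset.sum_le_sum fun a _ => ?_) hzcost⟩
  by_cases ha : N.cap a = 0
  · simpa [ha] using hz0 a
  · rw [if_neg ha]
    refine mul_le_mul_of_nonneg_left (max_le ?_ (hz0 a)) (N.cap_nonneg a)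
    have := hπw a
    simp only [z', if_neg ha] at this
    linarith

/-! ### The maximum flow over time as a function of the time horizon -/

section Horizon

variable [Fintype V] (N : FlowNetwork V A) {X Y : Finset V}

theorem exists_cutCost_eq_maxFlowOverTime (hXY : Disjoint X Y) {t : ℝ} (ht : 0 ≤ t) :
    ∃ π : V → ℝ, IsCutPotential X Y t π ∧ N.cutCost π = N.maxFlowOverTime X Y t := by
  obtain ⟨π, hπ, h⟩ := N.exists_cutCost_le_maxFlowOverTime hXY ht
  exact ⟨π, hπ, h.antisymm (N.maxFlowOverTime_le_cutCost hπ)⟩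

theorem monotoneOn_maxFlowOverTime (hXY : Disjoint X Y) :
    MonotoneOn (N.maxFlowOverTime X Y) (Set.Ici 0) := by
  intro s hs t ht hst
  obtain ⟨π, hπ, h⟩ := N.exists_cutCost_eq_maxFlowOverTime hXY ht
  rw [← h]
  have hπ' : IsCutPotential X Y s fun v => min (π v) s :=
    ⟨fun v hv => by simpa [hπ.1 v hv] using hs, fun v hv => by simpa [hπ.2 v hv] using hst⟩
  refine (N.maxFlowOverTime_le_cutCost hπ').trans (Finset.sum_le_sum fun a _ => ?_)
  refine mul_le_mul_of_nonneg_left (max_le ?_ (le_max_right _ _)) (N.cap_nonneg a)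
  have hτ := N.transit_nonneg a
  have h1 := le_max_left (π (N.tgt a) - π (N.src a) - N.transit a) 0
  have h2 := le_max_right (π (N.tgt a) - π (N.src a) - N.transit a) 0
  have h3 := min_le_left (π (N.tgt a)) s
  have h4 := min_le_right (π (N.tgt a)) s
  rcases min_choice (π (N.src a)) s with h | h <;> simp only [h] <;> linarith

theorem convexOn_maxFlowOverTime (hXY : Disjoint X Y) :
    ConvexOn ℝ (Set.Ici 0) (N.maxFlowOverTime X Y) := by
  refine ⟨convex_Ici 0, fun s hs t ht p q hp hq hpq => ?_⟩
  obtain ⟨π, hπ, hs'⟩ := N.exists_cutCost_eq_maxFlowOverTime hXY hs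
  obtain ⟨ρ, hρ, ht'⟩ := N.exists_cutCost_eq_maxFlowOverTime hXY ht
  have hmix : IsCutPotential X Y (p • s + q • t) fun v => p * π v + q * ρ v :=
    ⟨fun v hv => by simp [hπ.1 v hv, hρ.1 v hv], fun v hv => by simp [hπ.2 v hv, hρ.2 v hv]⟩
  refine (N.maxFlowOverTime_le_cutCost hmix).trans ?_
  rw [← hs', ← ht', cutCost, cutCost, cutCost, smul_eq_mul, smul_eq_mul, Finset.mul_sum,
    Finset.mul_sum, ← Finset.sum_add_distrib]
  refine Finset.sum_le_sum fun a _ => ?_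
  rw [mul_left_comm p, mul_left_comm q, ← mul_add]
  refine mul_le_mul_of_nonneg_left (max_le ?_ ?_) (N.cap_nonneg a)
  · have h1 := mul_le_mul_of_nonneg_left
      (le_max_left (π (N.tgt a) - π (N.src a) - N.transit a) 0) hp
    have h2 := mul_le_mul_of_nonneg_left
      (le_max_left (ρ (N.tgt a) - ρ (N.src a) - N.transit a) 0) hq
    have h3 : N.transit a = p * N.transit a + q * N.transit a := by rw [← add_mul, hpq, one_mul]
    linarith
  · exact add_nonneg (mul_nonneg hp (le_max_right _ _)) (mul_nonneg hq (le_max_right _ _))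

theorem maxFlowOverTime_empty_left (t : ℝ) : N.maxFlowOverTime ∅ Y t ≤ 0 := by
  have h := N.maxFlowOverTime_le_cutCost (X := ∅) (Y := Y) (t := t) (π := fun _ => t)
    ⟨by simp, by simp⟩
  refine h.trans (Finset.sum_nonpos fun a _ => ?_)
  rw [max_eq_right (by linarith [N.transit_nonneg a]), mul_zero]

omit [Fintype V] in
theorem maxFlowOverTime_of_isEmpty [IsEmpty A] (t : ℝ) : N.maxFlowOverTime X Y t = 0 := by
  have h : ∀ r ∈ {r : ℝ | ∃ f, N.IsFlowOverTime X Y t f ∧ r = ∑ v ∈ Y, N.excess f v t},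
      r = 0 := by
    rintro r ⟨f, _, rfl⟩
    simp [excess]
  exact le_antisymm (Real.sSup_nonpos fun r hr => (h r hr).le)
    (Real.sSup_nonneg fun r hr => (h r hr).ge)

/-! ### Breakpoints -/

/-- The reals `∑ ε a * transit a` with coefficients `ε a ∈ {-1, 0, 1}`. -/
def IsSignedTransitSum (N : FlowNetwork V A) (r : ℝ) : Prop :=
  ∃ ε : A → ℤ, (∀ a, |ε a| ≤ 1) ∧ r = ∑ a, (ε a : ℝ) * N.transit a

/-- The graph on the nodes whose edges are the arcs that are tight for the potential `π`. -/
def tightGraph (N : FlowNetwork V A) (π : V → ℝ) : SimpleGraph V :=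
  SimpleGraph.fromRel fun v w =>
    ∃ a, N.src a = v ∧ N.tgt a = w ∧ π w - π v = N.transit a

omit [Fintype V] [DecidableEq V] in
/-- As a trail repeats no edge, every arc contributes at most once to the potential difference of
its ends. -/
theorem exists_signs_of_isTrail (π : V → ℝ) {v w : V} (p : (N.tightGraph π).Walk v w)
    (hp : p.IsTrail) :
    ∃ ε : A → ℤ, (∀ a, |ε a| ≤ 1) ∧ (∀ a, ε a ≠ 0 → s(N.src a, N.tgt a) ∈ p.edges) ∧
      π w - π v = ∑ a, (ε a : ℝ) * N.transit a := by
  classical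
  induction p with
  | nil => exact ⟨0, by simp, by simp, by simp⟩
  | @cons u v w h p ih =>
    rw [SimpleGraph.Walk.isTrail_cons] at hp
    obtain ⟨ε, hε, hsupp, hsum⟩ := ih hp.1
    have hstep : ∃ a, ∃ σ : ℤ, |σ| ≤ 1 ∧ s(N.src a, N.tgt a) = s(u, v) ∧
        π v - π u = σ * N.transit a := by
      rcases (SimpleGraph.fromRel_adj _ _ _).1 h with ⟨_, ⟨a, hs, ht, ha⟩ | ⟨a, hs, ht, ha⟩⟩
      · exact ⟨a, 1, by simp, by rw [hs, ht], by rw [ha]; simp⟩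
      · exact ⟨a, -1, by simp, by rw [hs, ht, Sym2.eq_swap], by rw [← ha]; simp⟩
    obtain ⟨a, σ, hσ, hedge, ha⟩ := hstep
    have hεa : ε a = 0 := by
      by_contra hne
      exact hp.2 (hedge ▸ hsupp a hne)
    refine ⟨Function.update ε a σ, fun b => ?_, fun b hb => ?_, ?_⟩
    · by_cases hba : b = a
      · subst hba; simpa using hσ
      · simpa [hba] using hε b
    · rw [SimpleGraph.Walk.edges_cons, List.mem_cons]
      by_cases hba : b = a
      · subst hba; exact Or.inl hedge
      · exact Or.inr (hsupp b (by simpa [hba] using hb))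
    · have e : ∀ b, ((Function.update ε a σ b : ℤ) : ℝ) * N.transit b =
          (ε b : ℝ) * N.transit b + if b = a then (σ : ℝ) * N.transit a else 0 := by
        intro b
        by_cases hba : b = a
        · subst hba; simp [hεa]
        · simp [hba]
      simp only [e, Finset.sum_add_distrib, Finset.sum_ite_eq', Finset.mem_univ, if_true]
      linarith

/-- The time horizons at which the slope of the maximum flow over time changes are signed sums of
transit times. Otherwise no path of tight arcs of an optimal cut potential `π` joins `X` and `Y`,
and shifting `π` on the tight component of `Y` gives cuts for all nearby time horizons whose
capacity is an affine function of the time horizon. -/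
theorem differentiableAt_maxFlowOverTime (hXY : Disjoint X Y) {r : ℝ} (hr : 0 < r)
    (hne : ¬ N.IsSignedTransitSum r) : DifferentiableAt ℝ (N.maxFlowOverTime X Y) r := by
  classical
  obtain ⟨π, hπ, hcost⟩ := N.exists_cutCost_eq_maxFlowOverTime hXY hr.le
  let κ : V → ℝ := fun v => if ∃ y ∈ Y, (N.tightGraph π).Reachable y v then 1 else 0
  have hκY : ∀ v ∈ Y, κ v = 1 := fun v hv => if_pos ⟨v, hv, SimpleGraph.Reachable.refl v⟩
  have hκX : ∀ v ∈ X, κ v = 0 := by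
    refine fun v hv => if_neg ?_
    rintro ⟨y, hy, hreach⟩
    obtain ⟨p, hp⟩ := hreach.symm.exists_isPath
    obtain ⟨ε, hε, -, hsum⟩ := N.exists_signs_of_isTrail π p hp.isTrail
    exact hne ⟨ε, hε, by rw [← hsum, hπ.1 v hv, hπ.2 y hy, sub_zero]⟩
  set g : A → ℝ := fun a => π (N.tgt a) - π (N.src a) - N.transit a with hg
  have hκtight : ∀ a, g a = 0 → κ (N.tgt a) = κ (N.src a) := by
    intro a ha
    by_cases heq : N.tgt a = N.src a
    · rw [heq]
    have hadj : (N.tightGraph π).Adj (N.src a) (N.tgt a) :=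
      (SimpleGraph.fromRel_adj _ _ _).2 ⟨Ne.symm heq, Or.inl ⟨a, rfl, rfl, sub_eq_zero.1 ha⟩⟩
    have : (∃ y ∈ Y, (N.tightGraph π).Reachable y (N.tgt a)) ↔
        ∃ y ∈ Y, (N.tightGraph π).Reachable y (N.src a) :=
      ⟨fun ⟨y, hy, h⟩ => ⟨y, hy, h.trans hadj.reachable.symm⟩,
        fun ⟨y, hy, h⟩ => ⟨y, hy, h.trans hadj.reachable⟩⟩
    simp only [κ, this]
  -- the rate at which the shift changes the time during which arc `a` crosses the cut
  let c : A → ℝ := fun a => if 0 < g a then κ (N.tgt a) - κ (N.src a) else 0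
  have hlin : ∀ a, ∀ᶠ h in nhds (0 : ℝ),
      max (g a + h * (κ (N.tgt a) - κ (N.src a))) 0 = max (g a) 0 + c a * h := by
    intro a
    have hcont : Filter.Tendsto (fun h : ℝ => g a + h * (κ (N.tgt a) - κ (N.src a)))
        (nhds 0) (nhds (g a)) := by
      have : Continuous fun h : ℝ => g a + h * (κ (N.tgt a) - κ (N.src a)) := by fun_prop
      simpa using this.tendsto 0
    rcases lt_trichotomy (g a) 0 with h | h | h
    · filter_upwards [hcont.eventually (eventually_lt_nhds h)] with s hs
      simp [c, not_lt.2 h.le, max_eq_right h.le, max_eq_right hs.le]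
    · refine Filter.Eventually.of_forall fun s => ?_
      simp [c, h, hκtight a h]
    · filter_upwards [hcont.eventually (eventually_gt_nhds h)] with s hs
      simp only [c, if_pos h, max_eq_left h.le, max_eq_left hs.le]
      ring
  refine (N.convexOn_maxFlowOverTime hXY).differentiableAt_of_le_affine (Ici_mem_nhds hr)
    (c := ∑ a, N.cap a * c a) ?_
  filter_upwards [Filter.eventually_all.2 hlin] with h hh
  have hshift : IsCutPotential X Y (r + h) fun v => π v + h * κ v :=
    ⟨fun v hv => by simp [hπ.1 v hv, hκX v hv], fun v hv => by simp [hπ.2 v hv, hκY v hv]⟩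
  refine (N.maxFlowOverTime_le_cutCost hshift).trans_eq ?_
  rw [← hcost, cutCost, cutCost, Finset.sum_mul, ← Finset.sum_add_distrib]
  refine Finset.sum_congr rfl fun a _ => ?_
  rw [mul_assoc, ← mul_add, ← hh a]
  congr 2
  simp only [hg]
  ring

end Horizon

end FlowNetwork

/-! ### Counting geometrically approaching signed sums -/

theorem le_mul_log_of_two_pow_le {q m : ℕ} (hm : 1 ≤ m) (h : 2 ^ q ≤ (4 * q + 1) ^ m) :
    (q : ℝ) ≤ 15 * (m * Real.log (max (m : ℝ) 2)) := by
  have hm1 : (1 : ℝ) ≤ m := by exact_mod_cast hm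
  set M : ℝ := max (m : ℝ) 2 with hM
  have hM2 : (2 : ℝ) ≤ M := le_max_right _ _
  have hmM : (m : ℝ) ≤ M := le_max_left _ _
  set x : ℝ := q / m with hx
  have hx0 : 0 ≤ x := by positivity
  have hqx : (q : ℝ) = m * x := by rw [hx]; field_simp
  have hlog2 := Real.log_two_gt_d9
  have hL : Real.log 2 ≤ Real.log M := Real.log_le_log two_pos hM2
  have h1 : (q : ℝ) * Real.log 2 ≤ m * Real.log (4 * q + 1) := by
    have h' : ((2 : ℝ) ^ q) ≤ (4 * q + 1) ^ m := by exact_mod_cast h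
    have := Real.log_le_log (by positivity) h'
    rwa [Real.log_pow, Real.log_pow] at this
  have h2 : Real.log (4 * q + 1) ≤ Real.log M + Real.log (4 * x + 1) := by
    rw [← Real.log_mul (by positivity) (by positivity)]
    refine Real.log_le_log (by positivity) ?_
    rw [hqx]
    nlinarith
  -- the tangent of the logarithm at `12` has a slope that is small enough
  have h3 : Real.log (4 * x + 1) ≤ x / 3 + 4 * Real.log 2 := by
    have e : Real.log (4 * x + 1) = Real.log ((4 * x + 1) / 12) + Real.log 12 := by
      rw [← Real.log_mul (by positivity) (by norm_num)]
      congr 1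
      ring
    have h4 := Real.log_le_sub_one_of_pos (show 0 < (4 * x + 1) / 12 by positivity)
    have h5 : Real.log 12 ≤ 4 * Real.log 2 := by
      have : 4 * Real.log 2 = Real.log (2 ^ 4) := by rw [Real.log_pow]; norm_num
      rw [this]
      exact Real.log_le_log (by norm_num) (by norm_num)
    rw [e]
    linarith
  have h4 : x * Real.log 2 ≤ 5 * Real.log M + x / 3 := by
    have h5 : m * (x * Real.log 2) ≤ m * (5 * Real.log M + x / 3) := by
      rw [← mul_assoc, ← hqx]
      exact h1.trans (mul_le_mul_of_nonneg_left (by linarith) (by linarith))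
    exact le_of_mul_le_mul_left h5 (by linarith)
  have h5 : x ≤ 15 * Real.log M := by nlinarith
  rw [hqx]
  nlinarith

/-- Let `[a l, b l]`, `l < n`, be successive intervals to the left of `T`, each of which covers at
least half of the distance of `a l` to `T`. If each of them contains a signed sum `r l` of the
`τ a`, then their number is in `O(m log m)`. Indeed the distance of `r (3 * k)` to `T` decreases
by a factor of four with `k`, so that the differences `r (3 * (k + 1)) - r (3 * k)`, which do not
involve `T` any more, are superdecreasing. -/
theorem card_le_of_halving {A : Type*} [Fintype A] (hA : 1 ≤ Fintype.card A) (τ : A → ℝ) (n : ℕ)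
    (a b r : ℕ → ℝ) (T : ℝ) (haT : ∀ l < n, a l ≤ T) (hab : ∀ l < n, a l < b l)
    (hba : ∀ l, l + 1 < n → b l ≤ a (l + 1)) (hhalf : ∀ l < n, T - b l ≤ b l - a l)
    (har : ∀ l < n, a l ≤ r l) (hrb : ∀ l < n, r l ≤ b l)
    (hr : ∀ l < n, ∃ ε : A → ℤ, (∀ a, |ε a| ≤ 1) ∧ r l = ∑ a, (ε a : ℝ) * τ a) :
    (n : ℝ) ≤ 51 * (Fintype.card A * Real.log (max (Fintype.card A : ℝ) 2)) := by
  choose! ε hε hsum using hr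
  set q := (n - 2) / 3 with hq
  have hstep : ∀ k < q, T - r (3 * (k + 1)) ≤ (T - r (3 * k)) / 4 := by
    intro k hk
    have h0 := hrb (3 * k) (by omega)
    have h1 := hba (3 * k) (by omega)
    have h2 := hhalf (3 * k + 1) (by omega)
    have h3 := hba (3 * k + 1) (by omega)
    have h4 := hhalf (3 * k + 2) (by omega)
    have h5 := hba (3 * k + 2) (by omega)
    have h6 := har (3 * (k + 1)) (by omega)
    rw [show 3 * (k + 1) = 3 * k + 2 + 1 by ring] at h6 ⊢
    linarith
  have hnonneg : ∀ k, 3 * k + 1 < n → 0 ≤ T - r (3 * k) := by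
    intro k hkn
    linarith [hrb (3 * k) (by omega), hba (3 * k) (by omega), haT (3 * k + 1) (by omega)]
  have hpos : ∀ k < q, 0 < T - r (3 * k) := by
    intro k hk
    linarith [hrb (3 * k) (by omega), hba (3 * k) (by omega), hab (3 * k + 1) (by omega),
      hba (3 * k + 1) (by omega), haT (3 * k + 2) (by omega)]
  have hval : ∀ i : Fin q, ∑ c, ((ε (3 * (i.1 + 1)) c - ε (3 * i.1) c : ℤ) : ℝ) * τ c =
      r (3 * (i.1 + 1)) - r (3 * i.1) := by
    intro i
    rw [hsum _ (show 3 * (i.1 + 1) < n by omega), hsum _ (show 3 * i.1 < n by omega),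
      ← Finset.sum_sub_distrib]
    refine Finset.sum_congr rfl fun c _ => ?_
    push_cast
    ring
  have hpow : 2 ^ q ≤ (4 * q + 1) ^ Fintype.card A := by
    refine two_pow_le_of_superdecreasing τ
      (fun (i : Fin q) c => ε (3 * (i.1 + 1)) c - ε (3 * i.1) c) (fun i c => ?_) (fun i => ?_)
      fun i => ?_
    · have h1 := hε (3 * (i.1 + 1)) (by omega) c
      have h2 := hε (3 * i.1) (by omega) c
      rw [abs_le] at h1 h2 ⊢
      constructor <;> linarith
    · rw [hval]
      linarith [hstep i.1 i.2, hpos i.1 i.2]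
    · simp only [hval]
      have htel : ∑ j ∈ Finset.Ioi i, (r (3 * (j.1 + 1)) - r (3 * j.1)) =
          r (3 * q) - r (3 * (i.1 + 1)) := by
        have e : ∑ j ∈ Finset.Ioi i, (r (3 * (j.1 + 1)) - r (3 * j.1)) =
            ∑ j ∈ Finset.Ico (i.1 + 1) q, (r (3 * (j + 1)) - r (3 * j)) := by
          refine Finset.sum_bij (fun j _ => j.1) (fun j hj => ?_) (fun j _ l _ h => Fin.ext h)
            (fun j hj => ?_) fun j _ => rfl
          · have := Finset.mem_Ioi.1 hj
            exact Finset.mem_Ico.2 ⟨this, j.2⟩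
          · obtain ⟨h1, h2⟩ := Finset.mem_Ico.1 hj
            exact ⟨⟨j, h2⟩, Finset.mem_Ioi.2 h1, rfl⟩
        rw [e, Finset.sum_Ico_eq_sub _ (by omega), Finset.sum_range_sub (fun k => r (3 * k)),
          Finset.sum_range_sub (fun k => r (3 * k))]
        ring
      rw [htel]
      have hi := i.2
      linarith [hstep i.1 i.2, hpos i.1 i.2, hnonneg q (by omega)]
  have hq15 := le_mul_log_of_two_pow_le hA hpow
  have hn : (n : ℝ) ≤ 3 * q + 4 := by
    have : n ≤ 3 * q + 4 := by omega
    exact_mod_cast this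
  have hA1 : (1 : ℝ) ≤ Fintype.card A := by exact_mod_cast hA
  have hL : Real.log 2 ≤ Real.log (max (Fintype.card A : ℝ) 2) :=
    Real.log_le_log two_pos (le_max_right _ _)
  have hlog2 := Real.log_two_gt_d9
  nlinarith

namespace TransshipmentInstance

variable {V A : Type*} [Fintype V] [DecidableEq V] [Fintype A] (P : TransshipmentInstance V A)

/-! ### The functions `d` -/

omit [Fintype V] [Fintype A] in
theorem disjoint_inter_sdiff (S : Finset V) : Disjoint (P.sources ∩ S) (P.sinks \ S) :=
  P.disjoint.mono Finset.inter_subset_left Finset.sdiff_subset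

theorem convexOn_d (S : Finset V) : ConvexOn ℝ (Set.Ici 0) fun t => P.d t S := by
  have := (P.convexOn_maxFlowOverTime (P.disjoint_inter_sdiff S)).add_const (-∑ v ∈ S, P.b v)
  exact this

theorem d_mono (S : Finset V) {s t : ℝ} (hs : 0 ≤ s) (hst : s ≤ t) : P.d s S ≤ P.d t S :=
  sub_le_sub_right
    (P.monotoneOn_maxFlowOverTime (P.disjoint_inter_sdiff S) hs (hs.trans hst : (0 : ℝ) ≤ t) hst) _

omit [Fintype V] in
theorem dMin_le_d {S : Finset V} (hS : S ⊆ P.terminals) (t : ℝ) : P.dMin t ≤ P.d t S :=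
  Finset.inf'_le _ (Finset.mem_powerset.2 hS)

theorem dMin_mono {s t : ℝ} (hs : 0 ≤ s) (hst : s ≤ t) : P.dMin s ≤ P.dMin t :=
  Finset.le_inf' _ _ fun _ hS =>
    (P.dMin_le_d (Finset.mem_powerset.1 hS) s).trans (P.d_mono _ hs hst)

theorem dMin_nonpos (t : ℝ) : P.dMin t ≤ 0 := by
  refine (P.dMin_le_d (Finset.empty_subset _) t).trans ?_
  simpa [d, FlowNetwork.outFlow] using P.maxFlowOverTime_empty_left t

theorem IsBreakpoint.isSignedTransitSum {P : TransshipmentInstance V A} {S : Finset V} {r : ℝ}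
    (h : P.IsBreakpoint S r) : P.IsSignedTransitSum r := by
  rcases h.1.eq_or_lt with rfl | hr
  · exact ⟨0, by simp, by simp⟩
  · by_contra hne
    exact h.2 ((P.differentiableAt_maxFlowOverTime (P.disjoint_inter_sdiff S) hr hne).sub_const _)

omit [Fintype V] in
theorem not_isBreakpoint_of_isEmpty [IsEmpty A] (S : Finset V) (r : ℝ) : ¬ P.IsBreakpoint S r := by
  intro h
  apply h.2
  simp only [d, FlowNetwork.outFlow, P.maxFlowOverTime_of_isEmpty]
  fun_prop

/-- The left-hand derivative at `t` is at least the slope of any secant to the left. -/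
theorem slope_le_cut (S : Finset V) {s t : ℝ} (hs : 0 ≤ s) (hst : s < t) :
    (P.d t S - P.d s S) / (t - s) ≤ P.cut t S := by
  have := (P.convexOn_d S).slope_le_leftDeriv_of_mem_interior (x := s) (y := t) hs
    (by simpa using hs.trans_lt hst) hst
  have heq : (Set.Iio t : Set ℝ) =ᶠ[nhdsWithin t {t}ᶜ] Set.Iic t := by
    filter_upwards [self_mem_nhdsWithin] with y hy
    exact propext ⟨fun h => le_of_lt h, fun h => lt_of_le_of_ne h hy⟩
  rwa [slope_def_field, derivWithin_congr_set' t heq] at this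

/-! ### Runs of the Newton algorithm -/

namespace IsRun

variable {P} {θ θ' : ℕ → ℝ} {S : ℕ → Finset V}

omit [Fintype V] in
theorem nonneg (h : P.IsRun θ θ' S) {i : ℕ} (hi : i ∈ P.iterations θ) : 0 ≤ θ i := by
  cases i with
  | zero => exact h.start.ge
  | succ i =>
    have hi' : i ∈ P.iterations θ := fun l hl => hi l (by omega)
    exact (h.first_update i hi').1.1.trans ((h.second_update i hi').2 (Or.inl rfl))

theorem lt_first_update (h : P.IsRun θ θ' S) {i : ℕ} (hi : i ∈ P.iterations θ) :
    θ i < θ' i := by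
  have h0 := (h.first_update i hi).1
  have h1 : P.d (θ i) (S i) < 0 := (h.minimizer i hi).trans_lt (hi i le_rfl)
  by_contra! hle
  linarith [P.d_mono (S i) h0.1 hle, h0.2]

theorem lt_succ (h : P.IsRun θ θ' S) {i : ℕ} (hi : i ∈ P.iterations θ) : θ i < θ (i + 1) :=
  (h.lt_first_update hi).trans_le ((h.second_update i hi).2 (Or.inl rfl))

theorem le_of_lt (h : P.IsRun θ θ' S) {i j : ℕ} (hj : j ∈ P.iterations θ) (hij : i < j) :
    θ (i + 1) ≤ θ j := by
  obtain ⟨n, rfl⟩ := Nat.exists_eq_add_of_lt hij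
  induction n with
  | zero => exact le_rfl
  | succ n ih =>
    have hj' : i + n + 1 ∈ P.iterations θ := fun l hl => hj l (by omega)
    exact (ih hj' (by omega)).trans (h.lt_succ hj').le

theorem cut_pos (h : P.IsRun θ θ' S) {i : ℕ} (hi : i ∈ P.iterations θ) :
    0 < P.cut (θ' i) (S i) := by
  refine lt_of_lt_of_le ?_ (P.slope_le_cut (S i) (h.nonneg hi) (h.lt_first_update hi))
  rw [(h.first_update i hi).1.2, h.minimizer i hi]
  have := hi i le_rfl
  have := h.lt_first_update hi
  exact div_pos (by linarith) (by linarith)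

/-- The unit jump is no longer than the preceding Newton step, by convexity and monotonicity. -/
theorem unit_jump_le (h : P.IsRun θ θ' S) {i : ℕ} (hi : i ∈ P.iterations θ) :
    -P.dMin (θ' i) / P.cut (θ' i) (S i) ≤ θ' i - θ i := by
  have hlt := h.lt_first_update hi
  have hslope := P.slope_le_cut (S i) (h.nonneg hi) hlt
  rw [(h.first_update i hi).1.2, h.minimizer i hi, zero_sub, div_le_iff₀ (by linarith)] at hslope
  rw [div_le_iff₀ (h.cut_pos hi)]
  linarith [P.dMin_mono (h.nonneg hi) hlt.le]

/-- If the longest jump is not taken in iteration `i`, then `d` becomes `0` at a time whose distance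
to `θ (i + 1)` is at most `θ (i + 1) - θ i`: the jump twice as long, or the unit jump if there was
no jump at all, leads to such a time. -/
theorem exists_zero_near (h : P.IsRun θ θ' S) {i : ℕ} (hi : i ∈ P.iterations θ)
    (hi1 : i ∉ P.I1 θ θ' S) :
    ∃ T, 0 ≤ T ∧ 0 ≤ P.dMin T ∧ T - θ (i + 1) ≤ θ (i + 1) - θ i := by
  have hlt := h.lt_first_update hi
  have hunit := h.unit_jump_le hi
  have hcut := h.cut_pos hi
  have h0 := (h.first_update i hi).1.1
  have hup := h.second_update i hi
  set δ : ℝ := -P.dMin (θ' i) / P.cut (θ' i) (S i) with hδ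
  have hδ0 : 0 ≤ δ := div_nonneg (by linarith [P.dMin_nonpos (θ' i)]) hcut.le
  by_cases heq : θ (i + 1) = θ' i
  · refine ⟨θ' i + δ, by positivity, ?_, by linarith⟩
    by_contra! hneg
    have hle : θ' i + δ ≤ θ (i + 1) :=
      hup.2 (Or.inr ⟨hneg, 1, ⟨0, Nat.zero_le _, by simp⟩, by rw [jumpTime, one_mul]⟩)
    have hδz : δ = 0 := by linarith
    rw [hδz, add_zero] at hneg
    exact (div_pos (neg_pos.2 hneg) hcut).ne' hδz
  · rcases hup.1 with hup1 | ⟨-, j, ⟨e, he, rfl⟩, hj⟩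
    · exact absurd hup1 heq
    · have hne : e ≠ P.maxExp := by
        rintro rfl
        exact hi1 ⟨hi, Or.inr ⟨heq, ⟨_, le_rfl, rfl⟩, hj⟩⟩
      have hj' : θ (i + 1) = θ' i + 2 ^ e * δ := hj
      have hδpos : 0 < δ := by
        refine lt_of_le_of_ne hδ0 fun hz => heq ?_
        rw [hj', ← hz, mul_zero, add_zero]
      have hpow : (0 : ℝ) < 2 ^ e * δ := by positivity
      refine ⟨θ' i + 2 ^ (e + 1) * δ, by positivity, ?_, by rw [pow_succ]; linarith⟩
      by_contra! hneg
      have hle : θ' i + 2 ^ (e + 1) * δ ≤ θ (i + 1) :=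
        hup.2 (Or.inr ⟨hneg, _, ⟨e + 1, by omega, rfl⟩, rfl⟩)
      rw [pow_succ] at hle
      linarith

theorem card_le_of_subset_I2 (h : P.IsRun θ θ' S) (s : Finset ℕ) (hs : ↑s ⊆ P.I2 θ θ' S) :
    (s.card : ℝ) ≤ 51 * (Fintype.card A * Real.log (max (Fintype.card A : ℝ) 2)) := by
  rcases isEmpty_or_nonempty A with hA | hA
  · have : s = ∅ := by
      refine Finset.eq_empty_of_forall_notMem fun i hi => ?_
      obtain ⟨_, T, _, r, _, hr⟩ := hs hi
      exact P.not_isBreakpoint_of_isEmpty T r hr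
    simp [this]
  have hit : ∀ i ∈ s, i ∈ P.iterations θ := fun i hi => (hs hi).1.1
  choose! B hB r hr hbreak using fun i (hi : i ∈ s) => (hs hi).2
  choose! T hT0 hT hTnear using fun i (hi : i ∈ s) => h.exists_zero_near (hit i hi) (hs hi).1.2
  let idx : ℕ → ℕ := fun l => if hl : l < s.card then s.orderEmbOfFin rfl ⟨l, hl⟩ else 0
  have hidx : ∀ l < s.card, idx l ∈ s := by
    intro l hl
    simp only [idx, dif_pos hl]
    exact s.orderEmbOfFin_mem rfl _
  have hmono : ∀ l, l + 1 < s.card → idx l < idx (l + 1) := by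
    intro l hl
    simp only [idx, dif_pos hl, dif_pos (show l < s.card by omega)]
    exact (s.orderEmbOfFin rfl).strictMono (by simp)
  -- the times at which `d` vanishes
  set Z : Set ℝ := {t | 0 ≤ t ∧ 0 ≤ P.dMin t} with hZ
  have hZbdd : BddBelow Z := ⟨0, fun t ht => ht.1⟩
  refine card_le_of_halving Fintype.card_pos P.transit s.card (fun l => θ (idx l))
    (fun l => θ (idx l + 1)) (fun l => r (idx l)) (sInf Z) (fun l hl => ?_)
    (fun l hl => h.lt_succ (hit _ (hidx l hl)))
    (fun l hl => h.le_of_lt (hit _ (hidx _ hl)) (hmono l hl)) (fun l hl => ?_)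
    (fun l hl => (hr _ (hidx l hl)).1) (fun l hl => (hr _ (hidx l hl)).2)
    fun l hl => (hbreak _ (hidx l hl)).isSignedTransitSum
  · have hi := hidx l hl
    refine le_csInf ⟨T (idx l), hT0 _ hi, hT _ hi⟩ fun t ht => ?_
    by_contra! hlt
    linarith [P.dMin_mono ht.1 hlt.le, ht.2, hit _ hi _ le_rfl]
  · have hi := hidx l hl
    linarith [csInf_le hZbdd (show T (idx l) ∈ Z from ⟨hT0 _ hi, hT _ hi⟩), hTnear _ hi]

end IsRun

end TransshipmentInstance

theorem mainTheorem4 :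
    ∃ C : ℝ, ∀ (V A : Type*) [Fintype V] [DecidableEq V] [Fintype A]
      (P : TransshipmentInstance V A) (θ θ' : ℕ → ℝ) (S : ℕ → Finset V),
      P.IsRun θ θ' S →
        (P.I2 θ θ' S).Finite ∧
          ((P.I2 θ θ' S).ncard : ℝ) ≤
            C * (Fintype.card A * Real.log (max (Fintype.card A : ℝ) 2)) := by
  refine ⟨51, fun V A _ _ _ P θ θ' S h => ?_⟩
  have hfin : (P.I2 θ θ' S).Finite := by
    by_contra hinf
    obtain ⟨n, hn⟩ := exists_nat_gt (51 * (Fintype.card A *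
      Real.log (max (Fintype.card A : ℝ) 2)))
    obtain ⟨s, hs, rfl⟩ := Set.Infinite.exists_subset_card_eq hinf n
    exact absurd (h.card_le_of_subset_I2 s hs) (not_le.2 hn)
  refine ⟨hfin, ?_⟩
  rw [Set.ncard_eq_toFinset_card _ hfin]
  exact h.card_le_of_subset_I2 _ (by simp)
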